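/- Let $\mathbb C_+=\{s\in\mathbb C:\operatorname{Re}s>0\}$, let $\mathbb D_r=\{z\in\mathbb C:|z|<r\}$, and let $\operatorname{Arg}$ denote the principal argument, with values in $(-\pi,\pi]$. For $\tau>0$ and $a\le\frac1\tau$ define $\Lambda_{\tau,a}\subset\mathbb C$ as follows. (i) For $a<0$, $$\Lambda_{\tau,a}=\Big\{\eta\in\mathbb C\setminus\mathbb D_{|a|}:\ \operatorname{Re}\eta+a<0,\ |\eta|<|\eta_\pi|,\ |\operatorname{Arg}\eta|>\tau\sqrt{|\eta|^2-a^2}+\arctan\Big(-\tfrac1a\sqrt{|\eta|^2-a^2}\Big)\Big\}\cup\mathbb D_{|a|},$$ where $\eta_\pi\in\mathbb C$ with $|\eta_\pi|\geq|a|$ is such that $\tau\sqrt{|\eta_\pi|^2-a^2}+\arctan\big(-\frac1a\sqrt{|\eta_\pi|^2-a^2}\big)=\pi$ (this determines $|\eta_\pi|$). (ii) For $a=0$, $$\Lambda_{\tau,0}=\Big\{\eta\in\mathbb C\setminus\{0\}:\ \operatorname{Re}\eta<0,\ |\eta|<\tfrac{\pi}{2\tau},\ |\operatorname{Arg}\eta|>\tau|\eta|+\tfrac\pi2\Big\}.$$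 (iii) For $0<a<\frac1\tau$, $$\Lambda_{\tau,a}=\Big\{\eta\in\mathbb C:\ \operatorname{Re}\eta+a<0,\ |\eta|<|\eta_\pi|,\ |\operatorname{Arg}\eta|>\tau\sqrt{|\eta|^2-a^2}+\arctan\Big(-\tfrac1a\sqrt{|\eta|^2-a^2}\Big)+\pi\Big\},$$ where $\eta_\pi\in\mathbb C$ is such that $|\eta_\pi|>a$ and $\tau\sqrt{|\eta_\pi|^2-a^2}+\arctan\big(-\frac1a\sqrt{|\eta_\pi|^2-a^2}\big)=0$ (this determines $|\eta_\pi|$). For $a=\frac1\tau$ no such $\eta_\pi$ exists, and $\Lambda_{\tau,1/\tau}=\emptyset$. Theorem. Let $\tau>0$, $a\in\mathbb R$ and $\eta\in\mathbb C$. Then every solution $s\in\mathbb C$ of the equation $$s-a-\eta e^{-s\tau}=0$$ belongs to $\mathbb C\setminus\mathbb C_+$ if and only if $a\le\frac1\tau$ and either $\eta$ belongs to the closure of $\Lambda_{\tau,a}$, or $a=\frac1\tau$ and $\eta=-\frac1\tau$. -/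

import Mathlib

/-- The open right half-plane `ℂ₊`. -/
def rightHalfPlane : Set ℂ := {s : ℂ | 0 < s.re}

/-- The real number `√(|η|² - a²)`; it is only used where `|a| ≤ |η|`. -/
noncomputable def freq (a : ℝ) (η : ℂ) : ℝ := Real.sqrt (‖η‖ ^ 2 - a ^ 2)

/-- `τ √(|η|² - a²) + arctan (-(1/a) √(|η|² - a²))`, for `a ≠ 0`. -/
noncomputable def argSum (τ a : ℝ) (η : ℂ) : ℝ :=
  τ * freq a η + Real.arctan (-(1 / a) * freq a η)

/-- The region `Λ_{τ,a}` for `a < 0`. The defining equation of `p` (the point `η_π`) determines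
`|p|` uniquely. -/
noncomputable def regionNeg (τ a : ℝ) : Set ℂ :=
  {η : ℂ | η ∉ Metric.ball (0 : ℂ) |a| ∧ η.re + a < 0 ∧
      (∃ p : ℂ, argSum τ a p = Real.pi ∧ ‖η‖ < ‖p‖) ∧
      argSum τ a η < |Complex.arg η|} ∪ Metric.ball (0 : ℂ) |a|

/-- The region `Λ_{τ,0}`. -/
noncomputable def regionZero (τ : ℝ) : Set ℂ :=
  {η : ℂ | η ≠ 0 ∧ η.re < 0 ∧ ‖η‖ < Real.pi / (2 * τ) ∧
      τ * ‖η‖ + Real.pi / 2 < |Complex.arg η|}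

/-- The region `Λ_{τ,a}` for `0 < a ≤ 1/τ`. For `a < 1/τ` the conditions on `p` (the point `η_π`)
determine `|p|` uniquely; for `a = 1/τ` there is no such `p` and the region is empty. -/
noncomputable def regionPos (τ a : ℝ) : Set ℂ :=
  {η : ℂ | η.re + a < 0 ∧
      (∃ p : ℂ, a < ‖p‖ ∧ argSum τ a p = 0 ∧ ‖η‖ < ‖p‖) ∧
      argSum τ a η + Real.pi < |Complex.arg η|}

/-- The region `Λ_{τ,a}`, for `τ > 0` and `a ≤ 1/τ`. -/
noncomputable def stabilityRegion (τ a : ℝ) : Set ℂ :=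
  if a < 0 then regionNeg τ a
  else if a = 0 then regionZero τ
  else regionPos τ a

/-! ### Roots as values of `(s - a) exp (s τ)` -/

open Filter Topology

/-! The equation says `(s - a) exp (s τ) = η`. By conjugation, take `Im s ≥ 0`. Fixing the modulus
`r = |η|` and `x = Re s` determines `s`, and the phase of the value is `levelPhase τ a r x`. So an
unstable root exists essentially when this phase equals `|arg η|` for some `x > 0`.

The phase is continuous and vanishes for large `x`, so if it exceeds `|arg η|` at `x = 0` the
intermediate value theorem gives a root (`hasUnstableRoot_of_notMem`). If `a τ ≤ 1` and `|a| ≤ r`,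
it decreases strictly along the level curve (`levelPhase_lt`), so no root exists when its value at
`0` is at most `|arg η|`; for `|η| ≤ -a` a modulus estimate suffices (`not_hasUnstableRoot_of_mem`).
Hence for `a τ ≤ 1` stability is membership in `stableSet`.

At `x = 0` the phase is the bound defining the region, with a strict inequality there. For `a τ < 1`
the closure of the region is `stableSet`. For `a τ ≥ 1` `stableSet` collapses to `{-a}`, which is
stable exactly when `a τ = 1`. -/

/-- The real restriction of `s ↦ (s - a) exp (s τ)`. -/
noncomputable def realChar (τ a x : ℝ) : ℝ := (x - a) * Real.exp (x * τ)

/-- The phase of `(s - a) exp (s τ)` at the point `s` of the closed upper half-plane with real part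
`x` where this function has modulus `r`. -/
noncomputable def levelPhase (τ a r x : ℝ) : ℝ :=
  Real.arccos (realChar τ a x / r) +
    τ * (r * Real.exp (-(x * τ))) * Real.sqrt (1 - (realChar τ a x / r) ^ 2)

/-- The explicit set of all `η` for which the characteristic equation has no root in the open right
half-plane, provided that `a * τ ≤ 1`. -/
def stableSet (τ a : ℝ) : Set ℂ :=
  {η : ℂ | ‖η‖ ≤ -a ∨ (|a| ≤ ‖η‖ ∧ levelPhase τ a ‖η‖ 0 ≤ |Complex.arg η|)}

/-- `η` is a value of `(s - a) exp (s τ)` in the open right half-plane. -/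
def HasUnstableRoot (τ a : ℝ) (η : ℂ) : Prop :=
  ∃ s : ℂ, 0 < s.re ∧ (s - a) * Complex.exp (s * τ) = η

theorem char_eq_iff (τ a : ℝ) (η s : ℂ) :
    s - (a : ℂ) - η * Complex.exp (-(s * (τ : ℂ))) = 0 ↔
      (s - a) * Complex.exp (s * τ) = η := by
  have h := Complex.exp_ne_zero (s * τ)
  rw [Complex.exp_neg, sub_eq_zero, ← div_eq_mul_inv, eq_div_iff h]

theorem forall_compl_iff (τ a : ℝ) (η : ℂ) :
    (∀ s : ℂ, s - (a : ℂ) - η * Complex.exp (-(s * (τ : ℂ))) = 0 → s ∈ (rightHalfPlane)ᶜ) ↔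
      ¬ HasUnstableRoot τ a η := by
  simp only [char_eq_iff, HasUnstableRoot, rightHalfPlane, Set.mem_compl_iff, Set.mem_ofPred_eq,
    not_exists, not_and]
  exact forall_congr' fun s => ⟨fun h h1 h2 => h h2 h1, fun h h1 h2 => h h2 h1⟩

theorem HasUnstableRoot.conj {τ a : ℝ} {η : ℂ} (h : HasUnstableRoot τ a η) :
    HasUnstableRoot τ a ((starRingEnd ℂ) η) := by
  obtain ⟨s, hs, rfl⟩ := h
  refine ⟨(starRingEnd ℂ) s, by simpa using hs, ?_⟩
  simp [← Complex.exp_conj]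

theorem continuous_realChar (τ a : ℝ) : Continuous (realChar τ a) := by
  unfold realChar; fun_prop

theorem continuous_levelPhase (τ a r : ℝ) : Continuous (levelPhase τ a r) := by
  have := continuous_realChar τ a
  have := Real.continuous_arccos
  unfold levelPhase; fun_prop

/-! ### Level curves of the modulus in polar form -/

theorem eq_norm_mul_exp_abs_arg {η : ℂ} (h : 0 ≤ η.arg) :
    η = (‖η‖ : ℂ) * Complex.exp ((|η.arg| : ℝ) * Complex.I) := by
  rw [abs_of_nonneg h, Complex.norm_mul_exp_arg_mul_I]

/-- The point of the closed upper half-plane with real part `x` and given modulus of the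
characteristic function. -/
theorem hasUnstableRoot_polar {τ a r x : ℝ} (hr : 0 < r) (hx : 0 < x)
    (h : |realChar τ a x| ≤ r) :
    HasUnstableRoot τ a ((r : ℂ) * Complex.exp ((levelPhase τ a r x : ℝ) * Complex.I)) := by
  set β := Real.arccos (realChar τ a x / r) with hβ
  obtain ⟨h1, h2⟩ := abs_le.mp h
  have hcos : Real.cos β = realChar τ a x / r :=
    Real.cos_arccos (by rw [le_div_iff₀ hr]; linarith) (by rw [div_le_iff₀ hr]; linarith)
  have hsin : Real.sin β = Real.sqrt (1 - (realChar τ a x / r) ^ 2) := Real.sin_arccos _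
  have hexp : Real.exp (-(x * τ)) * Real.exp (x * τ) = 1 := by
    rw [← Real.exp_add]; simp
  have hre : r * Real.exp (-(x * τ)) * Real.cos β = x - a := by
    rw [hcos, realChar]; field_simp; linear_combination (x - a) * hexp
  have hs : ((x : ℂ) + (r * Real.exp (-(x * τ)) * Real.sin β : ℝ) * Complex.I) - a =
      (r * Real.exp (-(x * τ)) : ℝ) * Complex.exp (β * Complex.I) := by
    rw [Complex.exp_mul_I, ← Complex.ofReal_cos, ← Complex.ofReal_sin]
    apply Complex.ext <;> simp [-Complex.ofReal_exp, -Complex.ofReal_cos, -Complex.ofReal_sin]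
    linarith
  refine ⟨(x : ℂ) + (r * Real.exp (-(x * τ)) * Real.sin β : ℝ) * Complex.I,
    by rw [Complex.add_re, Complex.re_ofReal_mul]; simpa using hx, ?_⟩
  rw [hs, levelPhase, ← hβ, ← hsin]
  push_cast
  rw [mul_assoc, mul_assoc, ← Complex.exp_add, ← Complex.exp_add]
  congr 2
  ring

theorem exists_phase_of_root {τ a : ℝ} {η s : ℂ} (hη : η ≠ 0) (him : 0 ≤ s.im)
    (h : (s - a) * Complex.exp (s * τ) = η) :
    |realChar τ a s.re| ≤ ‖η‖ ∧
      η = (‖η‖ : ℂ) * Complex.exp ((levelPhase τ a ‖η‖ s.re : ℝ) * Complex.I) := by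
  have hr : 0 < ‖η‖ := norm_pos_iff.mpr hη
  have hnorm : ‖s - a‖ * Real.exp (s.re * τ) = ‖η‖ := by
    rw [← h, norm_mul, Complex.norm_exp]; simp
  have hexp : Real.exp (-(s.re * τ)) * Real.exp (s.re * τ) = 1 := by
    rw [← Real.exp_add]; simp
  have hρ : ‖s - a‖ = ‖η‖ * Real.exp (-(s.re * τ)) := by
    rw [← hnorm]; linear_combination -‖s - a‖ * hexp
  set β := (s - a).arg with hβ
  have hβ0 : 0 ≤ β := Complex.arg_nonneg_iff.mpr (by simpa using him)
  have hβπ : β ≤ Real.pi := Complex.arg_le_pi _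
  have hcos : ‖s - a‖ * Real.cos β = s.re - a := by
    rw [Complex.norm_mul_cos_arg]; simp
  have hsin : ‖s - a‖ * Real.sin β = s.im := by
    rw [Complex.norm_mul_sin_arg]; simp
  have hu : realChar τ a s.re = ‖η‖ * Real.cos β := by
    rw [realChar, ← hcos, ← hnorm]; ring
  have hu' : realChar τ a s.re / ‖η‖ = Real.cos β := by
    rw [hu]; field_simp
  have hsq : Real.sqrt (1 - Real.cos β ^ 2) = Real.sin β := by
    rw [← Real.sin_sq, Real.sqrt_sq (Real.sin_nonneg_of_nonneg_of_le_pi hβ0 hβπ)]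
  constructor
  · rw [hu, abs_mul, abs_of_pos hr]
    nlinarith [Real.abs_cos_le_one β]
  · rw [levelPhase, hu', Real.arccos_cos hβ0 hβπ, hsq, mul_assoc, ← hρ, hsin]
    have e1 : (s - a) = (‖s - a‖ : ℂ) * Complex.exp (β * Complex.I) :=
      (Complex.norm_mul_exp_arg_mul_I _).symm
    have e2 : (s * τ : ℂ) = (s.re * τ : ℝ) + (τ * s.im : ℝ) * Complex.I := by
      apply Complex.ext <;> simp [mul_comm]
    conv_lhs => rw [← h, e1, e2, Complex.exp_add, ← Complex.ofReal_exp]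
    rw [← hnorm]
    push_cast
    rw [add_mul, Complex.exp_add]
    ring

/-! ### Existence of unstable roots -/

theorem levelPhase_of_le {τ a r x : ℝ} (hr : 0 < r) (h : r ≤ realChar τ a x) :
    levelPhase τ a r x = 0 := by
  have h1 : 1 ≤ realChar τ a x / r := by rwa [le_div_iff₀ hr, one_mul]
  rw [levelPhase, Real.arccos_of_one_le h1, Real.sqrt_eq_zero_of_nonpos (by nlinarith)]
  simp

theorem levelPhase_of_le_neg {τ a r x : ℝ} (hr : 0 < r) (h : realChar τ a x ≤ -r) :
    levelPhase τ a r x = Real.pi := by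
  have h1 : realChar τ a x / r ≤ -1 := by rw [div_le_iff₀ hr]; linarith
  rw [levelPhase, Real.arccos_of_le_neg_one h1, Real.sqrt_eq_zero_of_nonpos (by nlinarith)]
  simp

theorem exists_le_realChar {τ : ℝ} (hτ : 0 < τ) (a r : ℝ) {x : ℝ} (hx : 0 ≤ x) :
    ∃ y, x < y ∧ r ≤ realChar τ a y := by
  refine ⟨|a| + |r| + 1 + x, by linarith [abs_nonneg a, abs_nonneg r], ?_⟩
  have h1 : 1 ≤ Real.exp ((|a| + |r| + 1 + x) * τ) := Real.one_le_exp (by positivity)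
  have h2 : |r| ≤ |a| + |r| + 1 + x - a := by linarith [le_abs_self a]
  rw [realChar]
  nlinarith [le_abs_self r, abs_nonneg r]

/-- Where `|realChar| > r` no point has modulus `r` and real part `x`, but the phase is frozen at
`0` or `π`. The same phase is then attained at a real `y > 0` with `realChar τ a y = ±r`. -/
theorem hasUnstableRoot_of_levelPhase_eq {τ a x : ℝ} {η : ℂ} (hτ : 0 < τ) (hη : η ≠ 0)
    (ha : -a < ‖η‖) (hx : 0 < x) (h : levelPhase τ a ‖η‖ x = |η.arg|) :
    HasUnstableRoot τ a η := by
  have hr : 0 < ‖η‖ := norm_pos_iff.mpr hη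
  have key : HasUnstableRoot τ a ((‖η‖ : ℂ) * Complex.exp ((|η.arg| : ℝ) * Complex.I)) := by
    rcases le_or_gt |realChar τ a x| ‖η‖ with hle | hgt
    · rw [← h]
      exact hasUnstableRoot_polar hr hx hle
    rcases lt_abs.mp hgt with h1 | h1
    · obtain ⟨y, hy, hy'⟩ := intermediate_value_Icc hx.le (continuous_realChar τ a).continuousOn
        (show ‖η‖ ∈ Set.Icc _ _ from ⟨by simpa [realChar] using ha.le, h1.le⟩)
      have hy0 : 0 < y := by
        rcases hy.1.lt_or_eq with h0 | h0
        · exact h0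
        · rw [← h0] at hy'; simp [realChar] at hy'; linarith
      rw [← h, levelPhase_of_le hr h1.le, ← levelPhase_of_le (τ := τ) (a := a) hr hy'.ge]
      exact hasUnstableRoot_polar hr hy0 (by rw [hy', abs_of_pos hr])
    · obtain ⟨z, hz, hz'⟩ := exists_le_realChar hτ a 0 hx.le
      obtain ⟨y, hy, hy'⟩ := intermediate_value_Icc hz.le (continuous_realChar τ a).continuousOn
        (show -‖η‖ ∈ Set.Icc _ _ from ⟨by linarith, by linarith⟩)
      rw [← h, levelPhase_of_le_neg hr (by linarith),
        ← levelPhase_of_le_neg (τ := τ) (a := a) hr hy'.le]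
      exact hasUnstableRoot_polar hr (hx.trans_le hy.1) (by rw [hy', abs_neg, abs_of_pos hr])
  rcases le_total 0 η.arg with h0 | h0
  · rwa [← eq_norm_mul_exp_abs_arg h0] at key
  · have := key.conj
    rwa [map_mul, Complex.conj_ofReal, ← Complex.exp_conj, map_mul, Complex.conj_ofReal,
      Complex.conj_I, abs_of_nonpos h0, mul_neg, Complex.ofReal_neg, neg_mul, neg_neg,
      Complex.norm_mul_exp_arg_mul_I] at this

theorem hasUnstableRoot_of_notMem {τ a : ℝ} {η : ℂ} (hτ : 0 < τ) (h : η ∉ stableSet τ a) :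
    HasUnstableRoot τ a η := by
  simp only [stableSet, Set.mem_ofPred_eq, not_or, not_le, not_and] at h
  obtain ⟨h1, h2⟩ := h
  by_cases hη : η = 0
  · subst hη
    exact ⟨a, by simpa using h1, by simp⟩
  have hr : 0 < ‖η‖ := norm_pos_iff.mpr hη
  -- If `|η| < a` and `|arg η| = π`, the phase equals `|arg η|` already at `0`, so the intermediate
  -- value argument might return `x = 0`. The phase stays frozen at `π` for small `x > 0`.
  have small (hlt : realChar τ a 0 < -‖η‖) (harg : |η.arg| = Real.pi) : HasUnstableRoot τ a η := by
    obtain ⟨x, hx, hx0⟩ := (((continuous_realChar τ a).continuousWithinAt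
      (s := Set.Ioi 0)).eventually_lt_const hlt |>.and self_mem_nhdsWithin).exists
    exact hasUnstableRoot_of_levelPhase_eq hτ hη h1 hx0 (by
      rw [harg, levelPhase_of_le_neg hr hx.le])
  have big (hlt : |η.arg| < levelPhase τ a ‖η‖ 0) : HasUnstableRoot τ a η := by
    obtain ⟨z, hz, hz'⟩ := exists_le_realChar hτ a ‖η‖ le_rfl
    obtain ⟨y, hy, hy'⟩ := intermediate_value_Icc' hz.le (continuous_levelPhase τ a ‖η‖).continuousOn
      (show |η.arg| ∈ Set.Icc _ _ from ⟨by rw [levelPhase_of_le hr hz']; positivity, hlt.le⟩)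
    refine hasUnstableRoot_of_levelPhase_eq hτ hη h1 (hy.1.lt_of_ne ?_) hy'
    rintro rfl
    exact hlt.ne' hy'
  rcases le_or_gt |a| ‖η‖ with h3 | h3
  · exact big (h2 h3)
  · have h4 : realChar τ a 0 < -‖η‖ := by
      rcases lt_abs.mp h3 with h | h
      · simpa [realChar] using h
      · linarith
    rcases (Complex.abs_arg_le_pi η).lt_or_eq with h5 | h5
    · exact big (by rwa [levelPhase_of_le_neg hr h4.le])
    · exact small h4 h5

/-! ### Monotonicity of the phase and absence of unstable roots -/

theorem hasDerivAt_realChar (τ a x : ℝ) :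
    HasDerivAt (realChar τ a) ((1 + τ * (x - a)) * Real.exp (x * τ)) x := by
  unfold realChar
  have h1 := ((hasDerivAt_id x).sub_const a)
  have h2 := ((hasDerivAt_id x).mul_const τ).exp
  exact (h1.mul h2).congr_deriv (by simp; ring)

theorem strictMonoOn_realChar {τ a : ℝ} (hτ : 0 < τ) (haτ : a * τ ≤ 1) :
    StrictMonoOn (realChar τ a) (Set.Ici 0) := by
  refine strictMonoOn_of_deriv_pos (convex_Ici 0) (continuous_realChar τ a).continuousOn ?_
  intro x hx
  rw [interior_Ici, Set.mem_Ioi] at hx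
  rw [(hasDerivAt_realChar τ a x).deriv]
  have : 0 < 1 + τ * (x - a) := by nlinarith
  positivity

theorem deriv_levelPhase_neg {τ a r x : ℝ} (hτ : 0 < τ) (hr : 0 < r)
    (h : |realChar τ a x| < r) : deriv (levelPhase τ a r) x < 0 := by
  obtain ⟨h1, h2⟩ := abs_lt.mp h
  set u := realChar τ a x / r with hu
  have hu1 : -1 < u := by rw [hu, lt_div_iff₀ hr]; linarith
  have hu2 : u < 1 := by rw [hu, div_lt_iff₀ hr]; linarith
  have hpos : 0 < 1 - u ^ 2 := by nlinarith
  have hd : HasDerivAt (fun x => realChar τ a x / r)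
      ((1 + τ * (x - a)) * Real.exp (x * τ) / r) x := (hasDerivAt_realChar τ a x).div_const r
  have hd1 := (Real.hasDerivAt_arccos (x := u) hu1.ne' hu2.ne).comp x hd
  have hd2 := ((hd.pow 2).const_sub 1).sqrt (by simpa using hpos.ne')
  have hd3 := ((((hasDerivAt_id x).mul_const τ).neg.exp).const_mul r).const_mul τ
  have hd4 := hd1.add (hd3.mul hd2)
  have : deriv (levelPhase τ a r) x = _ := HasDerivAt.deriv hd4
  rw [this]
  have hs : 0 < Real.sqrt (1 - u ^ 2) := Real.sqrt_pos.mpr hpos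
  have hss : Real.sqrt (1 - u ^ 2) ^ 2 = 1 - u ^ 2 := Real.sq_sqrt hpos.le
  have hexp : Real.exp (-(x * τ)) * Real.exp (x * τ) = 1 := by
    rw [← Real.exp_add]; simp
  have hru : r * Real.exp (-(x * τ)) * u = x - a := by
    rw [hu, realChar]; field_simp; linear_combination (x - a) * hexp
  simp only [Pi.pow_apply, ← hu, id, one_mul, Nat.cast_ofNat, Pi.neg_apply]
  set S := Real.sqrt (1 - u ^ 2)
  set E := Real.exp (-(x * τ)) with hE
  set G := Real.exp (x * τ) with hG
  have hE0 : 0 < E := Real.exp_pos _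
  have hG0 : 0 < G := Real.exp_pos _
  -- Since `r E u = x - a`, the arccosine term and the derivative of the square root combine into a
  -- perfect square.
  have : -((1 + τ * (x - a)) ^ 2 * G / r) / S - τ ^ 2 * r * E * S < 0 := by
    have : 0 ≤ (1 + τ * (x - a)) ^ 2 * G / r / S := by positivity
    have : 0 < τ ^ 2 * r * E * S := by positivity
    rw [neg_div]; linarith
  convert this using 1
  rw [← hru]
  field_simp
  ring

/-- Along a level curve of the modulus the phase decreases as the real part grows. -/
theorem levelPhase_lt {τ a r x : ℝ} (hτ : 0 < τ) (haτ : a * τ ≤ 1) (hr : 0 < r) (har : |a| ≤ r)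
    (hx : 0 < x) (h : |realChar τ a x| ≤ r) : levelPhase τ a r x < levelPhase τ a r 0 := by
  refine strictAntiOn_of_deriv_neg (convex_Icc 0 x) (continuous_levelPhase τ a r).continuousOn ?_
    (Set.left_mem_Icc.mpr hx.le) (Set.right_mem_Icc.mpr hx.le) hx
  intro y hy
  rw [interior_Icc] at hy
  apply deriv_levelPhase_neg hτ hr
  -- Monotonicity, from `a τ ≤ 1`, keeps `|realChar| < r` on the open interval, where the phase is
  -- differentiable.
  have hm := strictMonoOn_realChar hτ haτ
  have h1 := hm (Set.mem_Ici.mpr le_rfl) (Set.mem_Ici.mpr hy.1.le) hy.1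
  have h2 := hm (Set.mem_Ici.mpr hy.1.le) (Set.mem_Ici.mpr hx.le) hy.2
  have h0 : realChar τ a 0 = -a := by simp [realChar]
  rw [abs_lt]
  constructor <;> linarith [le_abs_self a, le_abs_self (realChar τ a x)]

theorem levelPhase_nonneg {τ a r x : ℝ} (hτ : 0 < τ) (hr : 0 ≤ r) : 0 ≤ levelPhase τ a r x :=
  add_nonneg (Real.arccos_nonneg _) (by positivity)

theorem stableSet_conj {τ a : ℝ} {η : ℂ} (h : η ∈ stableSet τ a) :
    (starRingEnd ℂ) η ∈ stableSet τ a := by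
  simp only [stableSet, Set.mem_ofPred_eq, Complex.norm_conj, Complex.arg_conj] at h ⊢
  split_ifs with h1
  · rwa [h1] at h
  · rwa [abs_neg]

theorem not_hasUnstableRoot_of_mem {τ a : ℝ} {η : ℂ} (hτ : 0 < τ) (haτ : a * τ ≤ 1)
    (h : η ∈ stableSet τ a) : ¬ HasUnstableRoot τ a η := by
  have upper (s η : ℂ) (h : η ∈ stableSet τ a) (him : 0 ≤ s.im) (hs : 0 < s.re)
      (hη : (s - a) * Complex.exp (s * τ) = η) : False := by
    have hnorm : ‖s - a‖ * Real.exp (s.re * τ) = ‖η‖ := by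
      rw [← hη, norm_mul, Complex.norm_exp]; simp
    rcases h with h | ⟨h1, h2⟩
    · have e1 : s.re - a ≤ ‖s - a‖ := by simpa using Complex.re_le_norm (s - a)
      have e2 : 1 ≤ Real.exp (s.re * τ) := Real.one_le_exp (by positivity)
      nlinarith [norm_nonneg (s - a), norm_nonneg η]
    · by_cases h0 : η = 0
      · subst h0
        have ha : a = 0 := by simpa using h1
        subst ha
        have : s = 0 := by simpa using hη
        simp [this] at hs
      have hr : 0 < ‖η‖ := norm_pos_iff.mpr h0
      obtain ⟨e1, e2⟩ := exists_phase_of_root h0 him hη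
      have e3 := levelPhase_lt hτ haτ hr h1 hs e1
      have e4 : 0 ≤ levelPhase τ a ‖η‖ s.re := levelPhase_nonneg hτ hr.le
      have e5 := Complex.abs_arg_le_pi η
      have e6 : η.arg = levelPhase τ a ‖η‖ s.re := by
        generalize levelPhase τ a ‖η‖ s.re = θ at e2 e3 e4
        -- The phase lies in `[0, π)`, so it is the principal argument.
        rw [e2, Complex.arg_real_mul _ hr, Complex.arg_exp_mul_I, toIocMod_eq_self]
        constructor <;> linarith
      rw [e6, abs_of_nonneg e4] at h2
      linarith
  rintro ⟨s, hs, hη⟩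
  rcases le_total 0 s.im with him | him
  · exact upper s η h him hs hη
  · refine upper ((starRingEnd ℂ) s) ((starRingEnd ℂ) η) (stableSet_conj h) (by simpa using him)
      (by simpa using hs) ?_
    rw [← hη]
    simp [← Complex.exp_conj]


/-! ### The phase on the imaginary axis -/

theorem levelPhase_zero (τ : ℝ) {a r : ℝ} (h : |a| ≤ r) :
    levelPhase τ a r 0 = Real.arccos (-a / r) + τ * Real.sqrt (r ^ 2 - a ^ 2) := by
  have h0 : realChar τ a 0 = -a := by simp [realChar]
  rcases ((abs_nonneg a).trans h).eq_or_lt with hr | hr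
  · subst hr
    have : a = 0 := by simpa using h
    simp [levelPhase, this]
  · have : r * Real.sqrt (1 - (-a / r) ^ 2) = Real.sqrt (r ^ 2 - a ^ 2) := by
      rw [← Real.sqrt_sq hr.le, ← Real.sqrt_mul (by positivity), Real.sqrt_sq hr.le]
      congr 1
      field_simp
    rw [levelPhase, h0, ← this]
    simp [mul_assoc]

theorem sqrt_one_sub_div_sq {a r : ℝ} (hr : 0 < r) :
    Real.sqrt (1 - (a / r) ^ 2) = Real.sqrt (r ^ 2 - a ^ 2) / r := by
  have : 1 - (a / r) ^ 2 = (r ^ 2 - a ^ 2) / r ^ 2 := by field_simp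
  rw [this, Real.sqrt_div' _ (by positivity), Real.sqrt_sq hr.le]

theorem levelPhase_zero_of_neg (τ : ℝ) {a : ℝ} {η : ℂ} (ha : a < 0) (h : |a| ≤ ‖η‖) :
    levelPhase τ a ‖η‖ 0 = argSum τ a η := by
  have hr : 0 < ‖η‖ := (abs_pos.mpr ha.ne).trans_le h
  rw [levelPhase_zero τ h, argSum, freq,
    Real.arccos_eq_arctan (div_pos (neg_pos.mpr ha) hr), sqrt_one_sub_div_sq hr, neg_sq, add_comm]
  congr 2
  have := ha.ne
  field_simp

theorem levelPhase_zero_of_pos (τ : ℝ) {a : ℝ} {η : ℂ} (ha : 0 < a) (h : |a| ≤ ‖η‖) :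
    levelPhase τ a ‖η‖ 0 = argSum τ a η + Real.pi := by
  have hr : 0 < ‖η‖ := (abs_pos.mpr ha.ne').trans_le h
  rw [levelPhase_zero τ h, argSum, freq, neg_div, Real.arccos_neg,
    Real.arccos_eq_arctan (div_pos ha hr), sqrt_one_sub_div_sq hr, neg_mul, Real.arctan_neg]
  have : Real.sqrt (‖η‖ ^ 2 - a ^ 2) / ‖η‖ / (a / ‖η‖) =
      1 / a * Real.sqrt (‖η‖ ^ 2 - a ^ 2) := by field_simp
  rw [this]
  ring

/-- `argSum` attains every value above its current one at a point of larger modulus. -/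
theorem exists_argSum_eq {τ a c : ℝ} {η : ℂ} (hτ : 0 < τ) (hη : |a| ≤ ‖η‖)
    (h : argSum τ a η < c) : ∃ p : ℂ, argSum τ a p = c ∧ ‖η‖ < ‖p‖ := by
  set A : ℝ → ℝ := fun w => τ * w + Real.arctan (-(1 / a) * w) with hA
  have hc : Continuous A := by
    have := Real.continuous_arctan
    fun_prop
  set w := freq a η with hw
  have hw0 : 0 ≤ w := Real.sqrt_nonneg _
  -- The increment gains `|c| + 2` in the linear term, and the arctangent loses less than `π / 2 <
  -- 2`.
  have hwW : w ≤ w + (|c| + 2) / τ := by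
    have : 0 < (|c| + 2) / τ := by positivity
    linarith
  have hW : c ≤ A (w + (|c| + 2) / τ) := by
    have h1 := Real.neg_pi_div_two_lt_arctan (-(1 / a) * (w + (|c| + 2) / τ))
    have h2 : τ * (w + (|c| + 2) / τ) = τ * w + (|c| + 2) := by field_simp
    simp only [hA]
    rw [h2]
    nlinarith [le_abs_self c, Real.pi_lt_four, mul_nonneg hτ.le hw0]
  obtain ⟨v, hv, hv'⟩ := intermediate_value_Icc hwW hc.continuousOn
    (show c ∈ Set.Icc _ _ from ⟨h.le, hW⟩)
  have hwv : w < v := by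
    refine hv.1.lt_of_ne ?_
    rintro rfl
    exact h.ne hv'
  have hv0 : 0 ≤ v := hw0.trans hv.1
  have hp : ‖((Real.sqrt (v ^ 2 + a ^ 2) : ℝ) : ℂ)‖ = Real.sqrt (v ^ 2 + a ^ 2) := by
    rw [Complex.norm_real, Real.norm_of_nonneg (Real.sqrt_nonneg _)]
  refine ⟨(Real.sqrt (v ^ 2 + a ^ 2) : ℝ), ?_, ?_⟩
  · have : freq a ((Real.sqrt (v ^ 2 + a ^ 2) : ℝ) : ℂ) = v := by
      rw [freq, hp, Real.sq_sqrt (by positivity), add_sub_cancel_right, Real.sqrt_sq hv0]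
    rw [argSum, this]
    exact hv'
  · rw [hp]
    apply Real.lt_sqrt_of_sq_lt
    have h1 : w ^ 2 = ‖η‖ ^ 2 - a ^ 2 :=
      Real.sq_sqrt (sub_nonneg.mpr (sq_le_sq.mpr (by rwa [abs_norm])))
    nlinarith

theorem re_eq_norm_mul_cos_abs_arg (η : ℂ) : η.re = ‖η‖ * Real.cos |η.arg| := by
  rw [Real.cos_abs, Complex.norm_mul_cos_arg]

theorem abs_arg_eq_arccos {η : ℂ} (hη : η ≠ 0) : |η.arg| = Real.arccos (η.re / ‖η‖) := by
  rw [← Complex.cos_arg hη, ← Real.cos_abs,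
    Real.arccos_cos (abs_nonneg _) (Complex.abs_arg_le_pi η)]

/-! ### The closure of the region and the stable set -/

theorem mem_stabilityRegion {τ a : ℝ} {η : ℂ} (hτ : 0 < τ) (h : |a| ≤ ‖η‖)
    (h' : levelPhase τ a ‖η‖ 0 < |η.arg|) : η ∈ stabilityRegion τ a := by
  have hπ := Complex.abs_arg_le_pi η
  have hη : η ≠ 0 := by
    rintro rfl
    have := levelPhase_nonneg (a := a) (x := 0) hτ (norm_nonneg (0 : ℂ))
    rw [Complex.arg_zero, abs_zero] at h'
    linarith
  have hr : 0 < ‖η‖ := norm_pos_iff.mpr hη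
  have hre : η.re + a < 0 := by
    have h1 : Real.arccos (-a / ‖η‖) < |η.arg| := by
      rw [levelPhase_zero τ h] at h'
      have : 0 ≤ τ * Real.sqrt (‖η‖ ^ 2 - a ^ 2) := by positivity
      linarith
    have h2 := Real.cos_lt_cos_of_nonneg_of_le_pi (Real.arccos_nonneg _) hπ h1
    obtain ⟨h3, h4⟩ := abs_le.mp h
    rw [Real.cos_arccos (by rw [le_div_iff₀ hr]; linarith) (by rw [div_le_iff₀ hr]; linarith),
      lt_div_iff₀ hr] at h2
    rw [re_eq_norm_mul_cos_abs_arg]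
    linarith
  rw [stabilityRegion]
  split_ifs with h1 h2
  · rw [levelPhase_zero_of_neg τ h1 h] at h'
    exact Or.inl ⟨by simpa using h, hre, exists_argSum_eq hτ h (h'.trans_le hπ), h'⟩
  · subst h2
    rw [levelPhase_zero τ h] at h'
    simp only [neg_zero, zero_div, Real.arccos_zero, ne_eq, OfNat.ofNat_ne_zero,
      not_false_eq_true, zero_pow, sub_zero, Real.sqrt_sq hr.le] at h'
    refine ⟨hη, by simpa using hre, ?_, by linarith⟩
    rw [lt_div_iff₀ (by positivity)]
    linarith
  · have ha : 0 < a := lt_of_le_of_ne (not_lt.mp h1) (Ne.symm h2)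
    rw [levelPhase_zero_of_pos τ ha h] at h'
    obtain ⟨p, hp, hp'⟩ := exists_argSum_eq (c := 0) hτ h (by linarith)
    exact ⟨hre, ⟨p, ((le_abs_self a).trans h).trans_lt hp', hp, hp'⟩, h'⟩

theorem stabilityRegion_subset (τ a : ℝ) : stabilityRegion τ a ⊆ stableSet τ a := by
  intro η h
  rw [stabilityRegion] at h
  split_ifs at h with h1 h2
  · rcases h with ⟨h3, -, -, h4⟩ | h3
    · have h3 : |a| ≤ ‖η‖ := by simpa using h3
      exact Or.inr ⟨h3, by rw [levelPhase_zero_of_neg τ h1 h3]; exact h4.le⟩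
    · rw [mem_ball_zero_iff, abs_of_neg h1] at h3
      exact Or.inl h3.le
  · subst h2
    obtain ⟨-, -, -, h3⟩ := h
    have h4 : |(0 : ℝ)| ≤ ‖η‖ := by simp
    refine Or.inr ⟨h4, ?_⟩
    rw [levelPhase_zero τ h4]
    simp
    linarith
  · have ha : 0 < a := lt_of_le_of_ne (not_lt.mp h1) (Ne.symm h2)
    obtain ⟨h3, -, h4⟩ := h
    have h5 : |a| ≤ ‖η‖ := by
      rw [abs_of_pos ha]
      linarith [Complex.abs_re_le_norm η, neg_abs_le η.re]
    exact Or.inr ⟨h5, by rw [levelPhase_zero_of_pos τ ha h5]; exact h4.le⟩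

theorem closure_stabilityRegion_subset (τ a : ℝ) :
    closure (stabilityRegion τ a) ⊆ stableSet τ a := by
  intro η h
  have hf : ∃ᶠ z in 𝓝 η, z ∈ stableSet τ a :=
    (mem_closure_iff_frequently.mp h).mono fun z hz => stabilityRegion_subset τ a hz
  by_contra hη
  have h1 : -a < ‖η‖ := by
    by_contra h1
    exact hη (Or.inl (not_lt.mp h1))
  have hf2 : ∃ᶠ z in 𝓝 η, |a| ≤ ‖z‖ ∧ levelPhase τ a ‖z‖ 0 ≤ |Complex.arg z| := by
    refine (hf.and_eventually (continuous_norm.continuousAt.eventually_const_lt h1)).mono ?_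
    rintro z ⟨hz | hz, hz'⟩
    · linarith
    · exact hz
  have h2 : |a| ≤ ‖η‖ :=
    ge_of_tendsto_of_frequently continuous_norm.continuousAt (hf2.mono fun z hz => hz.1)
  have h0 : η ≠ 0 := by
    rintro rfl
    have : a = 0 := by simpa using h2
    simp [this] at h1
  have hr : ‖η‖ ≠ 0 := norm_ne_zero_iff.mpr h0
  -- `arg` jumps across the negative axis, but `|arg z| = arccos (Re z / |z|)` is continuous away
  -- from `0`.
  have hc : ContinuousAt (fun z : ℂ => Real.arccos (z.re / ‖z‖) - levelPhase τ a ‖z‖ 0) η := by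
    have := Real.continuous_arccos
    unfold levelPhase
    fun_prop (disch := assumption)
  have h3 := ge_of_tendsto_of_frequently (b := 0) hc
    ((hf2.and_eventually (eventually_ne_nhds h0)).mono fun z hz => by
      rw [← abs_arg_eq_arccos hz.2]
      linarith [hz.1.2])
  simp only [← abs_arg_eq_arccos h0] at h3
  exact hη (Or.inr ⟨h2, by linarith⟩)

theorem strictConcaveOn_arctan : StrictConcaveOn ℝ (Set.Ici 0) Real.arctan := by
  refine StrictAntiOn.strictConcaveOn_of_deriv (convex_Ici 0)
    Real.continuous_arctan.continuousOn ?_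
  intro x hx y hy hxy
  rw [interior_Ici] at hx
  have hx : 0 < x := hx
  rw [(Real.hasDerivAt_arctan x).deriv, (Real.hasDerivAt_arctan y).deriv]
  exact one_div_lt_one_div_of_lt (by positivity) (by nlinarith)

theorem arctan_lt_self {x : ℝ} (hx : 0 < x) : Real.arctan x < x := by
  have h := Real.lt_tan (Real.arctan_pos.mpr hx) (Real.arctan_lt_pi_div_two x)
  rwa [Real.tan_arctan] at h

/-- At `w = 0` the slope `1 / a` of the arctangent beats `τ`. At `w > 0` strict concavity puts the
arctangent above its chord from `0` to `w`, which has slope `τ`. -/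
theorem frequently_lt_arctan {τ a w : ℝ} (ha : 0 < a) (haτ : a * τ < 1) (hw : 0 ≤ w)
    (h : τ * w = Real.arctan (w / a)) :
    ∃ᶠ v in 𝓝 w, 0 ≤ v ∧ τ * v < Real.arctan (v / a) := by
  rcases hw.eq_or_lt with rfl | hw
  · have hd : HasDerivAt (fun v => Real.arctan (v / a) - τ * v) (1 / a - τ) 0 := by
      refine (((hasDerivAt_id (0 : ℝ)).div_const a).arctan.sub
        ((hasDerivAt_id (0 : ℝ)).const_mul τ)).congr_deriv ?_
      simp
    have hpos : 0 < 1 / a - τ := by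
      rw [sub_pos, lt_div_iff₀ ha]
      linarith
    have hs := (hasDerivAt_iff_tendsto_slope.mp hd).eventually_const_lt hpos
    have hs' : ∀ᶠ v in 𝓝[>] (0 : ℝ), 0 ≤ v ∧ τ * v < Real.arctan (v / a) := by
      filter_upwards [nhdsWithin_mono _ (fun v (hv : v ∈ Set.Ioi 0) => ne_of_gt hv) hs,
        self_mem_nhdsWithin] with v hv hv0
      have hv0 : 0 < v := hv0
      rw [slope_def_field] at hv
      simp only [zero_div, Real.arctan_zero, mul_zero, sub_zero] at hv
      have := (div_pos_iff_of_pos_right hv0).mp hv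
      exact ⟨hv0.le, by linarith⟩
    exact hs'.frequently.filter_mono nhdsWithin_le_nhds
  · have hs' : ∀ᶠ v in 𝓝[<] w, 0 ≤ v ∧ τ * v < Real.arctan (v / a) := by
      filter_upwards [Ioo_mem_nhdsLT hw] with v hv
      refine ⟨hv.1.le, ?_⟩
      have hvw : 0 < v / w := div_pos hv.1 hw
      have hvw' : v / w < 1 := (div_lt_one hw).mpr hv.2
      have hwa : 0 < w / a := div_pos hw ha
      have := strictConcaveOn_arctan.2 Set.self_mem_Ici (Set.mem_Ici.mpr hwa.le) hwa.ne
        (sub_pos.mpr hvw') hvw (sub_add_cancel _ _)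
      simp only [smul_eq_mul, Real.arctan_zero, mul_zero, zero_add, ← h] at this
      have e1 : v / w * (τ * w) = τ * v := by field_simp
      have e2 : v / w * (w / a) = v / a := by field_simp
      rwa [e1, e2] at this
    exact hs'.frequently.filter_mono nhdsWithin_le_nhds

theorem levelPhase_zero_eq_sub_arctan (τ : ℝ) {a r : ℝ} (ha : 0 < a) (h : a ≤ r) :
    levelPhase τ a r 0 = Real.pi + τ * Real.sqrt (r ^ 2 - a ^ 2) -
      Real.arctan (Real.sqrt (r ^ 2 - a ^ 2) / a) := by
  have hn : ‖(r : ℂ)‖ = r := by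
    rw [Complex.norm_real, Real.norm_of_nonneg (ha.le.trans h)]
  have := levelPhase_zero_of_pos τ (η := (r : ℂ)) ha (by rwa [hn, abs_of_pos ha])
  rw [argSum, freq, hn, neg_mul, Real.arctan_neg, one_div_mul_eq_div] at this
  rw [this]
  ring

theorem frequently_levelPhase_lt_pi {τ a r : ℝ} (hτ : 0 < τ) (haτ : a * τ < 1) (h : |a| ≤ r)
    (hr : levelPhase τ a r 0 = Real.pi) :
    ∃ᶠ ρ in 𝓝 r, |a| ≤ ρ ∧ 0 < ρ ∧ levelPhase τ a ρ 0 < Real.pi := by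
  rcases le_or_gt a 0 with ha | ha
  · have har : |a| < r := by
      refine h.lt_of_ne ?_
      rintro rfl
      rw [levelPhase_zero τ h, sq_abs, sub_self, Real.sqrt_zero, mul_zero, add_zero,
        Real.arccos_eq_pi, abs_of_nonpos ha] at hr
      have : 0 ≤ -a / -a := div_nonneg (by linarith) (by linarith)
      linarith
    have : ∀ᶠ ρ in 𝓝[<] r, |a| ≤ ρ ∧ 0 < ρ ∧ levelPhase τ a ρ 0 < Real.pi := by
      filter_upwards [Ioo_mem_nhdsLT har] with ρ hρ
      have hρ0 : 0 < ρ := (abs_nonneg a).trans_lt hρ.1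
      refine ⟨hρ.1.le, hρ0, ?_⟩
      rw [← hr, levelPhase_zero τ h, levelPhase_zero τ hρ.1.le]
      have h1 : Real.arccos (-a / ρ) ≤ Real.arccos (-a / r) :=
        Real.antitone_arccos (div_le_div_of_nonneg_left (by linarith) hρ0 hρ.2.le)
      have h2 : Real.sqrt (ρ ^ 2 - a ^ 2) < Real.sqrt (r ^ 2 - a ^ 2) := by
        apply Real.sqrt_lt_sqrt
        · exact sub_nonneg.mpr (sq_le_sq.mpr (by rw [abs_of_pos hρ0]; exact hρ.1.le))
        · nlinarith [hρ.2]
      nlinarith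
    exact this.frequently.filter_mono nhdsWithin_le_nhds
  · rw [abs_of_pos ha] at h ⊢
    rw [levelPhase_zero_eq_sub_arctan τ ha h] at hr
    set w := Real.sqrt (r ^ 2 - a ^ 2) with hw
    have hf := frequently_lt_arctan (τ := τ) ha haτ (Real.sqrt_nonneg _) (w := w) (by linarith)
    have hsq : w ^ 2 = r ^ 2 - a ^ 2 := Real.sq_sqrt (by nlinarith)
    have ht : Tendsto (fun v => Real.sqrt (v ^ 2 + a ^ 2)) (𝓝 w) (𝓝 r) := by
      have : Continuous fun v => Real.sqrt (v ^ 2 + a ^ 2) := by fun_prop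
      have := this.tendsto w
      rwa [hsq, sub_add_cancel, Real.sqrt_sq (ha.le.trans h)] at this
    refine ht.frequently (hf.mono ?_)
    rintro v ⟨hv0, hv⟩
    have h1 : a ≤ Real.sqrt (v ^ 2 + a ^ 2) := Real.le_sqrt_of_sq_le (by nlinarith)
    refine ⟨h1, ha.trans_le h1, ?_⟩
    rw [levelPhase_zero_eq_sub_arctan τ ha h1, Real.sq_sqrt (by positivity),
      add_sub_cancel_right, Real.sqrt_sq hv0]
    linarith

theorem neg_mem_closure_stabilityRegion {τ a r : ℝ} (hτ : 0 < τ)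
    (h : ∃ᶠ ρ in 𝓝 r, |a| ≤ ρ ∧ 0 < ρ ∧ levelPhase τ a ρ 0 < Real.pi) :
    -(r : ℂ) ∈ closure (stabilityRegion τ a) := by
  have ht : Tendsto (fun ρ : ℝ => -(ρ : ℂ)) (𝓝 r) (𝓝 (-(r : ℂ))) :=
    (Complex.continuous_ofReal.neg).tendsto r
  refine mem_closure_iff_frequently.mpr (ht.frequently (h.mono ?_))
  rintro ρ ⟨h1, h2, h3⟩
  have hn : ‖-(ρ : ℂ)‖ = ρ := by rw [norm_neg, Complex.norm_real, Real.norm_of_nonneg h2.le]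
  have harg : (-(ρ : ℂ)).arg = Real.pi := by
    rw [← Complex.ofReal_neg]; exact Complex.arg_ofReal_of_neg (by linarith)
  exact mem_stabilityRegion hτ (by rwa [hn]) (by rwa [hn, harg, abs_of_pos Real.pi_pos])

/-- A boundary point with `|arg η| < π` is approached by rotating towards the negative axis at fixed
modulus. On the negative axis no larger argument is available, so the modulus is varied instead. -/
theorem subset_closure_stabilityRegion {τ a : ℝ} (hτ : 0 < τ) (haτ : a * τ < 1) :
    stableSet τ a ⊆ closure (stabilityRegion τ a) := by
  intro η h
  rcases h with h | ⟨h1, h2⟩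
  · have ha : a ≤ 0 := by linarith [norm_nonneg η]
    rcases ha.eq_or_lt with rfl | ha
    · have hη : η = -((0 : ℝ) : ℂ) := by simpa using h
      rw [hη]
      apply neg_mem_closure_stabilityRegion hτ
      have : ∀ᶠ ρ in 𝓝[>] (0 : ℝ), |(0 : ℝ)| ≤ ρ ∧ 0 < ρ ∧ levelPhase τ 0 ρ 0 < Real.pi := by
        filter_upwards [Ioo_mem_nhdsGT (show 0 < Real.pi / (2 * τ) by positivity)] with ρ hρ
        have h0 : |(0 : ℝ)| ≤ ρ := by simpa using hρ.1.le
        refine ⟨h0, hρ.1, ?_⟩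
        have h1 := (lt_div_iff₀ (by positivity)).mp hρ.2
        rw [levelPhase_zero τ h0]
        simp [Real.sqrt_sq hρ.1.le]
        linarith
      exact this.frequently.filter_mono nhdsWithin_le_nhds
    · have hs : Metric.ball (0 : ℂ) |a| ⊆ stabilityRegion τ a := by
        rw [stabilityRegion, if_pos ha]
        exact Set.subset_union_right
      apply closure_mono hs
      rw [closure_ball _ (abs_pos.mpr ha.ne).ne', mem_closedBall_zero_iff, abs_of_neg ha]
      exact h
  rcases h2.lt_or_eq with h2 | h2
  · exact subset_closure (mem_stabilityRegion hτ h1 h2)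
  rcases (Complex.abs_arg_le_pi η).lt_or_eq with h3 | h3
  · have hr : 0 < ‖η‖ := by
      refine norm_pos_iff.mpr ?_
      rintro rfl
      have ha : a = 0 := by simpa using h1
      subst ha
      rw [levelPhase_zero τ h1] at h2
      simp at h2
    obtain ⟨σ, hσ⟩ : ∃ σ : ℝ, ∀ t, 0 < t → |η.arg + σ * t| = |η.arg| + t := by
      rcases le_or_gt 0 η.arg with h0 | h0
      · refine ⟨1, fun t ht => ?_⟩
        rw [abs_of_nonneg h0, abs_of_nonneg (by linarith), one_mul]
      · refine ⟨-1, fun t ht => ?_⟩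
        rw [abs_of_neg h0, abs_of_neg (by linarith)]
        ring
    have hc : Continuous fun t : ℝ =>
        (‖η‖ : ℂ) * Complex.exp ((η.arg + σ * t : ℝ) * Complex.I) := by fun_prop
    have ht := hc.tendsto 0
    simp only [mul_zero, add_zero, Complex.norm_mul_exp_arg_mul_I] at ht
    refine mem_closure_of_tendsto (ht.mono_left (nhdsWithin_le_nhds (s := Set.Ioi 0))) ?_
    filter_upwards [Ioo_mem_nhdsGT (sub_pos.mpr h3)] with t ht
    have hθ := hσ t ht.1
    have hlt : |η.arg + σ * t| < Real.pi := by linarith [ht.2]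
    set θ := η.arg + σ * t
    have hn : ‖(‖η‖ : ℂ) * Complex.exp (θ * Complex.I)‖ = ‖η‖ := by
      rw [norm_mul, Complex.norm_exp_ofReal_mul_I, mul_one, Complex.norm_real, norm_norm]
    apply mem_stabilityRegion hτ
    · rwa [hn]
    · rw [hn, Complex.arg_real_mul _ hr, Complex.arg_exp_mul_I, (toIocMod_eq_self _).mpr, hθ, h2]
      · linarith [ht.1]
      · obtain ⟨h4, h5⟩ := abs_lt.mp hlt
        constructor <;> linarith
  · have harg : η.arg = Real.pi := by
      rcases abs_eq Real.pi_pos.le |>.mp h3 with h4 | h4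
      · exact h4
      · exact absurd h4 (Complex.neg_pi_lt_arg η).ne'
    have hη : η = -(‖η‖ : ℂ) := by
      have := Complex.norm_mul_exp_arg_mul_I η
      rw [harg, Complex.exp_pi_mul_I] at this
      linear_combination -this
    rw [hη]
    exact neg_mem_closure_stabilityRegion hτ
      (frequently_levelPhase_lt_pi hτ haτ h1 (h2.trans h3))

/-! ### The case `a τ ≥ 1` and the conclusion -/

theorem levelPhase_zero_self (τ : ℝ) {a : ℝ} (ha : 0 < a) : levelPhase τ a a 0 = Real.pi := by
  rw [levelPhase_zero_eq_sub_arctan τ ha le_rfl]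
  simp

/-- With `w = √(|η|² - a²)`, membership forces `τ w ≤ arctan (w / a)`, whereas `arctan (w / a) < w /
a ≤ τ w` for `w > 0`. So `w = 0` and `|arg η| = π`. -/
theorem mem_stableSet_iff_eq_neg {τ a : ℝ} {η : ℂ} (hτ : 0 < τ) (haτ : 1 ≤ a * τ) :
    η ∈ stableSet τ a ↔ η = -(a : ℂ) := by
  have ha : 0 < a := pos_of_mul_pos_left (by linarith) hτ.le
  constructor
  · rintro (h | ⟨h1, h2⟩)
    · linarith [norm_nonneg η]
    rw [abs_of_pos ha] at h1
    have h3 := Complex.abs_arg_le_pi η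
    rw [levelPhase_zero_eq_sub_arctan τ ha h1] at h2
    set w := Real.sqrt (‖η‖ ^ 2 - a ^ 2) with hw
    have hw0 : w = 0 := by
      by_contra hne
      have hpos : 0 < w := lt_of_le_of_ne (Real.sqrt_nonneg _) (Ne.symm hne)
      have h4 := arctan_lt_self (div_pos hpos ha)
      have h5 : w / a ≤ τ * w := by
        rw [div_le_iff₀ ha]
        nlinarith
      linarith
    have hnorm : ‖η‖ = a := by
      have := Real.sqrt_eq_zero'.mp (hw.symm.trans hw0)
      nlinarith
    have hcos : η.re = -a := by
      have h6 : |η.arg| = Real.pi := by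
        rw [hw0] at h2
        simp at h2
        linarith
      rw [re_eq_norm_mul_cos_abs_arg, h6, hnorm]
      simp
    have him : η.im = 0 := by
      have := Complex.sq_norm_sub_sq_re η
      rw [hnorm, hcos] at this
      nlinarith
    apply Complex.ext <;> simp [hcos, him]
  · rintro rfl
    have hn : ‖-(a : ℂ)‖ = a := by rw [norm_neg, Complex.norm_real, Real.norm_of_nonneg ha.le]
    have harg : (-(a : ℂ)).arg = Real.pi := by
      rw [← Complex.ofReal_neg]
      exact Complex.arg_ofReal_of_neg (by linarith)
    refine Or.inr ⟨by rw [hn, abs_of_pos ha], ?_⟩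
    rw [hn, levelPhase_zero_self τ ha, harg, abs_of_pos Real.pi_pos]

/-- For `a τ > 1`, `realChar` has negative slope at `0`, so it drops below `-a` and the phase is
frozen at `π` for some `x > 0`. -/
theorem hasUnstableRoot_neg {τ a : ℝ} (hτ : 0 < τ) (haτ : 1 < a * τ) :
    HasUnstableRoot τ a (-(a : ℂ)) := by
  have ha : 0 < a := pos_of_mul_pos_left (by linarith) hτ.le
  have hn : ‖-(a : ℂ)‖ = a := by rw [norm_neg, Complex.norm_real, Real.norm_of_nonneg ha.le]
  have harg : (-(a : ℂ)).arg = Real.pi := by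
    rw [← Complex.ofReal_neg]
    exact Complex.arg_ofReal_of_neg (by linarith)
  have hs := (hasDerivAt_iff_tendsto_slope.mp (hasDerivAt_realChar τ a 0)).eventually_lt_const
    (show (1 + τ * (0 - a)) * Real.exp (0 * τ) < 0 by simp; linarith)
  obtain ⟨x, hx, hx0⟩ := ((hs.filter_mono (nhdsWithin_mono _
    fun v (hv : v ∈ Set.Ioi 0) => ne_of_gt hv)).and self_mem_nhdsWithin).exists
  have hx0 : 0 < x := hx0
  have h0 : realChar τ a 0 = -a := by simp [realChar]
  rw [slope_def_field, sub_zero, div_lt_iff₀ hx0, zero_mul, h0] at hx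
  refine hasUnstableRoot_of_levelPhase_eq hτ (neg_ne_zero.mpr (by exact_mod_cast ha.ne'))
    (by rw [hn]; linarith) hx0 ?_
  rw [hn, harg, levelPhase_of_le_neg ha (by linarith), abs_of_pos Real.pi_pos]

theorem mainTheorem1 (τ a : ℝ) (η : ℂ) (hτ : 0 < τ) :
    (∀ s : ℂ, s - (a : ℂ) - η * Complex.exp (-(s * (τ : ℂ))) = 0 → s ∈ (rightHalfPlane)ᶜ) ↔
      a ≤ 1 / τ ∧
        (η ∈ closure (stabilityRegion τ a) ∨ (a = 1 / τ ∧ η = -(1 / (τ : ℂ)))) := by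
  rw [forall_compl_iff, le_div_iff₀ hτ]
  constructor
  · intro h
    have hη : η ∈ stableSet τ a := by
      by_contra hη
      exact h (hasUnstableRoot_of_notMem hτ hη)
    rcases lt_or_ge (a * τ) 1 with h1 | h1
    · exact ⟨h1.le, Or.inl (subset_closure_stabilityRegion hτ h1 hη)⟩
    rw [mem_stableSet_iff_eq_neg hτ h1] at hη
    rcases h1.lt_or_eq with h1 | h1
    · exact absurd (hη ▸ hasUnstableRoot_neg hτ h1) h
    · have ha : a = 1 / τ := (eq_div_iff hτ.ne').mpr h1.symm
      refine ⟨h1.ge, Or.inr ⟨ha, ?_⟩⟩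
      rw [hη, ha]
      push_cast
      rfl
  · rintro ⟨h1, h⟩
    apply not_hasUnstableRoot_of_mem hτ h1
    rcases h with h | ⟨ha, h⟩
    · exact closure_stabilityRegion_subset τ a h
    · rw [mem_stableSet_iff_eq_neg hτ ((eq_div_iff hτ.ne').mp ha).ge, h, ha]
      push_cast
      rfl
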